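/- **Theorem 4.1 (Bäcklund transformations of the sigma forms).** Let $\mathbb K=\mathbb R$ or $\mathbb C$, $n\ge 1$, $t_1,\dots,t_{n-1},\alpha\in\mathbb K$, and put $t_n=1$, $t_0=-z$ (where $z$ is the independent variable). *Lenard operators and hierarchy.* Let $\mathcal L_k[u]$ be the differential polynomials in $u$ with $\mathcal L_0[u]=\tfrac12$, $\ \frac{d}{dz}\mathcal L_{k+1}=\big(\frac{d^3}{dz^3}+4u\frac{d}{dz}+2u_z\big)\mathcal L_k$ and $\mathcal L_{k}[0]=0$ for $k\ge1$. For a function $w$ write $\mathcal L_k=\mathcal L_k[w_z-w^2]$ and $\mathcal V_k=\big(\frac{d}{dz}+2w\big)\mathcal L_k$. The $n$-th member of the second Painlevé hierarchy is $$\mathrm P_{\rm II}^{(n)}(\alpha):\qquad \mathcal V_n+\sum_{l=1}^{n-1}t_l\,\mathcal V_l=zw+\alpha .$$ A solution on an open set is a $C^\infty$ function there (holomorphic if $\mathbb K=\mathbb C$) that satisfies this equation. *Matrix entries.* Put, as functions of $z$ (entries not listed are $0$), $$A^{(l)}_{2l+1}=4^l,\qquad A^{(l)}_{2k+1}=\tfrac{4^{k+1}}2\Big(\mathcal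 L_{l-k}-\tfrac{d}{dz}\mathcal V_{l-k-1}\Big),\quad B^{(l)}_{2k+1}=\tfrac{4^{k+1}}2\,\tfrac{d}{dz}\mathcal V_{l-k-1}\quad(0\le k<l),$$ $$B^{(l)}_{2k}=-4^k\,\mathcal V_{l-k}\quad(1\le k\le l),$$ $$a_{2k+1}=\sum_{l=1}^n t_lA^{(l)}_{2k+1}-\delta_{k,0}\,z,\qquad b_{2k+1}=\sum_{l=1}^n t_lB^{(l)}_{2k+1},\qquad b_{2k}=\sum_{l=1}^n t_lB^{(l)}_{2k}\ (k\ge1),\qquad b_0=-\alpha .$$ *Canonical coordinates and sigma function.* Let $P_k=\big(a_{2(n-k)+1}+b_{2(n-k)+1}\big)/a_{2n+1}$ and $$Q_k=\sum_{j=1}^n\frac{b_{2j}}{2j}\,\frac{\partial S_{2j}}{\partial \Pi_{2k}}\qquad(1\le k\le n),$$ where the power sum $S_{2j}=q_1^{2j}+\dots+q_{2n}^{2j}$ is regarded as a polynomial in the elementary symmetric polynomials $\Pi_1,\dots,\Pi_{2n}$ of $q_1,\dots,q_{2n}$ and the derivative is evaluated at $\Pi_{2i}=P_i$, $\Pi_{2i-1}=0$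 $(1\le i\le n)$. The sigma function $\sigma_n=\sigma_n[w,\alpha]$ of a solution $w$ of $\mathrm P_{\rm II}^{(n)}(\alpha)$ is the value of the Hamiltonian along $w$: $$\sigma_n=-\frac1{4^n}\Big(\sum_{l=0}^{n-1}a_{2l+1}a_{2(n-l)-1}-\sum_{l=0}^{n-1}b_{2l+1}b_{2(n-l)-1}+\sum_{l=0}^{n}b_{2l}b_{2(n-l)}\Big)+\frac{Q_n}{4^n}.$$ *Claim.* Let $w$ be a solution of $\mathrm P_{\rm II}^{(n)}(\alpha)$ on an open set $U\subseteq\mathbb K$. 1. (Generator $s$.) Let $G=2\sum_{l=0}^n t_l\,\mathcal L_l[w_z-w^2]$. On $V=\{z\in U: G(z)\ne0\}$ the function $\tilde w=w-\dfrac{2\alpha-1}{G}$ is a solution of $\mathrm P_{\rm II}^{(n)}(1-\alpha)$, and $\sigma_n[\tilde w,1-\alpha]=\sigma_n[w,\alpha]$ on $V$. 2. (Generator $r$.) The function $-w$ is a solution of $\mathrm P_{\rm II}^{(n)}(-\alpha)$ on $U$, and $\sigma_n[-w,-\alpha]=\sigma_n[w,\alpha]-2w$ on $U$. -/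

import Mathlib

namespace PainleveII

open MvPolynomial
open scoped ContDiff

/-! ### Differential polynomials and the Lenard operators -/

/-- Differential polynomials in one unknown `u`; the variable `X k` is the `k`-th derivative
of `u`. -/
abbrev DiffPoly : Type := MvPolynomial ℕ ℚ

/-- The total derivative `d/dz`, i.e. the derivation with `u⁽ᵏ⁾ ↦ u⁽ᵏ⁺¹⁾`. -/
noncomputable def totalDeriv : Derivation ℚ DiffPoly DiffPoly :=
  mkDerivation ℚ (fun k : ℕ => (X (k + 1) : DiffPoly))

/-- The operator `d³/dz³ + 4 u d/dz + 2 u_z` on differential polynomials. -/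
noncomputable def lenardOp (f : DiffPoly) : DiffPoly :=
  totalDeriv (totalDeriv (totalDeriv f)) + 4 * X 0 * totalDeriv f + 2 * X 1 * f

/-- The Lenard differential polynomials `L_k[u]`: `L_0 = 1/2`, and `L_{k+1}` is the differential
polynomial with `d/dz L_{k+1} = (d³/dz³ + 4 u d/dz + 2 u_z) L_k` and `L_{k+1}[0] = 0`.
That it exists is `lenard_spec`; it is unique because only constants have total derivative zero. -/
noncomputable def lenard : ℕ → DiffPoly
  | 0 => C (1 / 2)
  | k + 1 => Classical.epsilon fun F : DiffPoly =>
      totalDeriv F = lenardOp (lenard k) ∧ constantCoeff F = 0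

theorem lenardOp_skew (f g : DiffPoly) :
    f * lenardOp g + g * lenardOp f =
      totalDeriv (f * totalDeriv (totalDeriv g) - totalDeriv f * totalDeriv g
        + totalDeriv (totalDeriv f) * g + 4 * X 0 * f * g) := by
  have h0 : totalDeriv (X 0 : DiffPoly) = X 1 := by simp [totalDeriv, mkDerivation_X]
  have h4 : totalDeriv (4 : DiffPoly) = 0 := by
    exact_mod_cast totalDeriv.map_natCast 4
  simp only [lenardOp, map_add, map_sub, Derivation.leibniz, smul_eq_mul, h0, h4]
  ring

/-- The recursion and the boundary condition that define the Lenard operators. -/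
theorem lenard_spec (k : ℕ) :
    totalDeriv (lenard (k + 1)) = lenardOp (lenard k) ∧ constantCoeff (lenard (k + 1)) = 0 := by
  induction k using Nat.strong_induction_on with
  | _ k ih =>
    suffices h : ∃ F : DiffPoly, totalDeriv F = lenardOp (lenard k) ∧ constantCoeff F = 0 by
      have := Classical.epsilon_spec h
      rw [lenard]
      exact this
    suffices h : ∃ F : DiffPoly, totalDeriv F = lenardOp (lenard k) by
      obtain ⟨F, hF⟩ := h
      refine ⟨F - C (constantCoeff F), ?_, by simp⟩
      have hC : totalDeriv (C (constantCoeff F)) = 0 := derivation_C totalDeriv _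
      rw [map_sub, hF, hC, sub_zero]
    have key : ∀ j, j ≤ k → ∃ G : DiffPoly, totalDeriv G =
        lenard 0 * lenardOp (lenard k) - lenard j * lenardOp (lenard (k - j)) := by
      intro j
      induction j with
      | zero => intro _; exact ⟨0, by simp⟩
      | succ j ihj =>
        intro hj
        obtain ⟨G, hG⟩ := ihj (by omega)
        obtain ⟨b, hb⟩ : ∃ b, k - j = b + 1 := ⟨k - j - 1, by omega⟩
        have hb' : k - (j + 1) = b := by omega
        have e1 := (ih j (by omega)).1
        have e2 := (ih b (by omega)).1
        have e3 := lenardOp_skew (lenard j) (lenard (b + 1))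
        rw [hb] at hG
        rw [hb']
        refine ⟨G + ((lenard j * totalDeriv (totalDeriv (lenard (b + 1)))
          - totalDeriv (lenard j) * totalDeriv (lenard (b + 1))
          + totalDeriv (totalDeriv (lenard j)) * lenard (b + 1)
          + 4 * X 0 * lenard j * lenard (b + 1)) - lenard (j + 1) * lenard (b + 1)), ?_⟩
        rw [map_add, hG, map_sub, ← e3, Derivation.leibniz, smul_eq_mul, smul_eq_mul, e1, e2]
        ring
    obtain ⟨G, hG⟩ := key k le_rfl
    have e3 := lenardOp_skew (lenard k) (lenard 0)
    rw [Nat.sub_self] at hG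
    refine ⟨G + (lenard k * totalDeriv (totalDeriv (lenard 0))
        - totalDeriv (lenard k) * totalDeriv (lenard 0)
        + totalDeriv (totalDeriv (lenard k)) * lenard 0 + 4 * X 0 * lenard k * lenard 0), ?_⟩
    rw [map_add, hG, ← e3]
    have h2 : (lenard 0 : DiffPoly) + lenard 0 = 1 := by
      rw [lenard, ← C_add]
      norm_num
    linear_combination (lenardOp (lenard k)) * h2

variable {𝕜 : Type*} [RCLike 𝕜]

/-- `evalDiff F u z` is the value `F[u](z)` of the differential polynomial `F` at the
function `u`. -/
noncomputable def evalDiff (F : DiffPoly) (u : 𝕜 → 𝕜) (z : 𝕜) : 𝕜 :=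
  aeval (fun k => iteratedDeriv k u z) F

/-- The function `w_z - w²`. -/
noncomputable def miura (w : 𝕜 → 𝕜) (z : 𝕜) : 𝕜 := deriv w z - w z ^ 2

/-- `𝓛_k[w_z - w²]`, as a function of `z`. -/
noncomputable def lenardAt (k : ℕ) (w : 𝕜 → 𝕜) (z : 𝕜) : 𝕜 := evalDiff (lenard k) (miura w) z

/-- `(d/dz + 2 w) 𝓛_k[w_z - w²]`, as a function of `z`. -/
noncomputable def lenardShift (k : ℕ) (w : 𝕜 → 𝕜) (z : 𝕜) : 𝕜 :=
  deriv (lenardAt k w) z + 2 * w z * lenardAt k w z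

/-! ### The second Painlevé hierarchy -/

/-- The coefficients `t_0 = -z`, the parameters `t_1, …, t_{n-1}`, and `t_n = 1`
(only the values `t 1, …, t (n - 1)` of the given sequence are used). -/
def time (n : ℕ) (t : ℕ → 𝕜) (z : 𝕜) (l : ℕ) : 𝕜 :=
  if l = 0 then -z else if l = n then 1 else t l

/-- `w` is a smooth (for `𝕜 = ℂ`: holomorphic) solution on `U` of the `n`-th member of the second
Painlevé hierarchy with parameters `t_1, …, t_{n-1}` and `α`. -/
def IsSolution (n : ℕ) (t : ℕ → 𝕜) (α : 𝕜) (U : Set 𝕜) (w : 𝕜 → 𝕜) : Prop :=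
  ContDiffOn 𝕜 ∞ w U ∧ ∀ z ∈ U,
    lenardShift n w z + ∑ l ∈ Finset.Icc 1 (n - 1), t l * lenardShift l w z = z * w z + α

/-! ### The entries of the isomonodromic matrix -/

/-- The entry `A_{2k+1}^{(l)}`. -/
noncomputable def entryA (l k : ℕ) (w : 𝕜 → 𝕜) (z : 𝕜) : 𝕜 :=
  if k = l then 4 ^ l
  else if k < l then
    4 ^ (k + 1) / 2 * (lenardAt (l - k) w z - deriv (lenardShift (l - k - 1) w) z)
  else 0

/-- The entry `B_{2k+1}^{(l)}`. -/
noncomputable def entryBodd (l k : ℕ) (w : 𝕜 → 𝕜) (z : 𝕜) : 𝕜 :=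
  if k < l then 4 ^ (k + 1) / 2 * deriv (lenardShift (l - k - 1) w) z else 0

/-- The entry `B_{2k}^{(l)}`. -/
noncomputable def entryBeven (l k : ℕ) (w : 𝕜 → 𝕜) (z : 𝕜) : 𝕜 :=
  if 1 ≤ k ∧ k ≤ l then -4 ^ k * lenardShift (l - k) w z else 0

/-- `a_{2k+1}^{(n)}`. -/
noncomputable def coeffA (n : ℕ) (t : ℕ → 𝕜) (w : 𝕜 → 𝕜) (k : ℕ) (z : 𝕜) : 𝕜 :=
  ∑ l ∈ Finset.Icc 1 n, time n t z l * entryA l k w z - if k = 0 then z else 0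

/-- `b_{2k+1}^{(n)}`. -/
noncomputable def coeffBodd (n : ℕ) (t : ℕ → 𝕜) (w : 𝕜 → 𝕜) (k : ℕ) (z : 𝕜) : 𝕜 :=
  ∑ l ∈ Finset.Icc 1 n, time n t z l * entryBodd l k w z

/-- `b_{2k}^{(n)}`, with `b_0^{(n)} = -α`. -/
noncomputable def coeffBeven (n : ℕ) (t : ℕ → 𝕜) (α : 𝕜) (w : 𝕜 → 𝕜) (k : ℕ) (z : 𝕜) : 𝕜 :=
  if k = 0 then -α else ∑ l ∈ Finset.Icc 1 n, time n t z l * entryBeven l k w z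

/-! ### Canonical coordinates, Hamiltonian and sigma function -/

/-- The power sum `S_k = q_1^k + … + q_{2n}^k` as a polynomial in the elementary symmetric
polynomials `Π_1, …, Π_{2n}` of `q_1, …, q_{2n}`; the variable `X i` is `Π_{i+1}`. -/
noncomputable def powerSum (n k : ℕ) : MvPolynomial (Fin (2 * n)) ℚ :=
  (esymmAlgEquiv (Fin (2 * n)) ℚ (Fintype.card_fin (2 * n))).symm
    ⟨psum (Fin (2 * n)) ℚ k, psum_isSymmetric (Fin (2 * n)) ℚ k⟩

/-- The canonical coordinate `P_k`, for `1 ≤ k ≤ n`. -/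
noncomputable def coordP (n : ℕ) (t : ℕ → 𝕜) (w : 𝕜 → 𝕜) (k : ℕ) (z : 𝕜) : 𝕜 :=
  (coeffA n t w (n - k) z + coeffBodd n t w (n - k) z) / coeffA n t w n z

/-- The values `Π_1, …, Π_{2n}` of the elementary symmetric polynomials at the roots
`q_1, …, q_{2n}` of `∑_{k<n} (b_{2k+1} + a_{2k+1}) q^{2k} + a_{2n+1} q^{2n}`: by Vieta
`Π_{2k} = P_k`, and `Π_m = 0` for odd `m` as this is a polynomial in `q²`. Index `i` stands for
`Π_{i+1}`. -/
noncomputable def elemSymm (n : ℕ) (t : ℕ → 𝕜) (w : 𝕜 → 𝕜) (z : 𝕜) (i : Fin (2 * n)) : 𝕜 :=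
  if Even ((i : ℕ) + 1) then coordP n t w (((i : ℕ) + 1) / 2) z else 0

/-- The canonical coordinate `Q_k = ∑_{j=1}^n b_{2j} / (2j) · ∂S_{2j}/∂Π_{2k}`; the argument
`k : Fin n` stands for `Q_{k+1}`. -/
noncomputable def coordQ (n : ℕ) (t : ℕ → 𝕜) (α : 𝕜) (w : 𝕜 → 𝕜) (k : Fin n) (z : 𝕜) : 𝕜 :=
  ∑ j ∈ Finset.Icc 1 n, 1 / (2 * (j : 𝕜)) * coeffBeven n t α w j z *
    aeval (elemSymm n t w z)
      (pderiv (⟨2 * (k : ℕ) + 1, by omega⟩ : Fin (2 * n)) (powerSum n (2 * j)))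

/-- The sigma function `σ_n(z)`: the value along `w` of the Hamiltonian
`-4⁻ⁿ (∑ a_{2l+1} a_{2(n-l)-1} - ∑ b_{2l+1} b_{2(n-l)-1} + ∑ b_{2l} b_{2(n-l)}) + 4⁻ⁿ Q_n`
of the `n`-th member of the hierarchy. -/
noncomputable def sigma (n : ℕ) (hn : 1 ≤ n) (t : ℕ → 𝕜) (α : 𝕜) (w : 𝕜 → 𝕜) (z : 𝕜) : 𝕜 :=
  -(1 / 4 ^ n) *
      (∑ l ∈ Finset.range n, coeffA n t w l z * coeffA n t w (n - l - 1) z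
        - ∑ l ∈ Finset.range n, coeffBodd n t w l z * coeffBodd n t w (n - l - 1) z
        + ∑ l ∈ Finset.range (n + 1), coeffBeven n t α w l z * coeffBeven n t α w (n - l) z)
    + coordQ n t α w ⟨n - 1, by omega⟩ z / 4 ^ n

/-! ### The generator `s` of the Bäcklund transformations -/

/-- The denominator `2 ∑_{l=0}^n t_l 𝓛_l[w_z - w²]`, with `t_0 = -z` and `t_n = 1`. -/
noncomputable def sDenom (n : ℕ) (t : ℕ → 𝕜) (w : 𝕜 → 𝕜) (z : 𝕜) : 𝕜 :=
  2 * ∑ l ∈ Finset.range (n + 1), time n t z l * lenardAt l w z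

/-- The function `w̃ = w - (2α - 1) / (2 ∑_{l=0}^n t_l 𝓛_l[w_z - w²])`. -/
noncomputable def sTransform (n : ℕ) (t : ℕ → 𝕜) (α : 𝕜) (w : 𝕜 → 𝕜) (z : 𝕜) : 𝕜 :=
  w z - (2 * α - 1) / sDenom n t w z

end PainleveII

/-!
Write `u = w_z - w²` and `ℓ_k = ∑_{l=k}^n t_l 𝓛_{l-k}[u]`, so that the denominator of the generator
`s` is `G = 2 ℓ_0`. Since `t_0 = -z`, the equation `P_II^{(n)}(α)` says precisely that
`(d/dz + 2 w) ℓ_0 = α - 1/2` (`lenardSumShift_zero_eq_iff`).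

*The coordinate `Q_n`.* By Newton's identities `∂S_{2j}/∂Π_{2n}` vanishes for `j < n` and is `-2n`
for `j = n` (`pderiv_last_powerSum`), so that `Q_n = -b_{2n} = 4ⁿ w`.

*The generator `s`.* The equation gives `G_z + 2 w G = 2 α - 1`, which is what makes
`w̃ = w - (2 α - 1) / G` have the same `u` (`miura_sTransform`). Hence all `ℓ_k` are unchanged, and
`(d/dz + 2 w̃) ℓ_0 = (α - 1/2) - (2 α - 1) = (1 - α) - 1/2`. The matrix entries are
`a_{2k+1} = (4^{k+1}/2) (ℓ_k - v_{k+1}')`, `b_{2k+1} = (4^{k+1}/2) v_{k+1}'` and `b_{2k} = -4^k v_k`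
with `v_k = (d/dz + 2 w) ℓ_k`, up to a correction at `b_0 = -α = -(v_0 + 1/2)`. Substituting them
in the Hamiltonian, where `v_0' = 0` along a solution and the correction cancels `Q_n/4ⁿ = w`,
everything that involves `w` combines to `u` (`hamiltonian_reduction`, `sigma_eq`):
`σ_n = -∑ ℓ_l ℓ_{n-1-l} - ∑ (ℓ_l' ℓ_{n-l}' - 2 ℓ_l ℓ_{n-l}'' - 4 u ℓ_l ℓ_{n-l})`.
This is invariant under `s`.

*The generator `r`.* For `u = w_z - w²` the Lenard operator factors as
`(d - 2 w) d (d + 2 w)`. Comparing this with the factorization for `-w`, one finds by induction that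
`𝓥_k` is odd in `w` and that `𝓛_{k+1}` changes by `-2 𝓥_k'` (`shiftNegPoly_eq`,
`miuraNeg_lenard_succ`). The constants of integration are controlled in the ring of differential
polynomials, where only constants have total derivative zero (`eq_C_of_totalDeriv_eq_zero`). So the
`a_{2k+1}` are even and all `b_k` are odd; the quadratic part of the Hamiltonian is invariant, and
`Q_n/4ⁿ = w` changes by `-2 w`.
-/

namespace PainleveII

open MvPolynomial
open scoped ContDiff

/-! ### The kernel of the total derivative -/

@[simp] theorem totalDeriv_X (k : ℕ) : totalDeriv (X k : DiffPoly) = X (k + 1) :=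
  mkDerivation_X ℚ _ k

/-- The commutator of `∂/∂u⁽ᵏ⁺¹⁾` with `d/dz` is `∂/∂u⁽ᵏ⁾`. -/
theorem pderiv_succ_totalDeriv (k : ℕ) (F : DiffPoly) :
    pderiv (k + 1) (totalDeriv F) = totalDeriv (pderiv (k + 1) F) + pderiv k F := by
  have h : ⁅pderiv (R := ℚ) (k + 1), totalDeriv⁆ = pderiv k := by
    refine derivation_ext fun i => ?_
    rw [Derivation.commutator_apply, totalDeriv_X, pderiv_X, pderiv_X, pderiv_X]
    have h1 : totalDeriv (Pi.single (M := fun _ : ℕ => DiffPoly) (k + 1) 1 i) = 0 := by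
      by_cases hi : i = k + 1
      · subst hi; simp
      · simp [hi]
    rw [h1, sub_zero]
    simp [Pi.single_apply]
  rw [← h, Derivation.commutator_apply]
  ring

theorem eq_C_of_pderiv_eq_zero {F : DiffPoly} (h : ∀ k, pderiv k F = 0) :
    F = C (constantCoeff F) := by
  ext m
  rw [coeff_C]
  split_ifs with hm
  · rw [← hm, constantCoeff_eq]
  · obtain ⟨k, hk⟩ := Finsupp.ne_iff.1 (Ne.symm hm)
    have hk1 : 1 ≤ m k := Nat.one_le_iff_ne_zero.2 hk
    have := coeff_pderiv (i := k) F (m - Finsupp.single k 1)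
    rw [h k, coeff_zero, tsub_add_cancel_of_le (by simpa using hk1)] at this
    have h2 : ((((m - Finsupp.single k 1 : ℕ →₀ ℕ) k : ℕ) : ℚ) + 1) ≠ 0 := by positivity
    exact (mul_eq_zero.1 this.symm).resolve_right h2

/-- A differential polynomial with total derivative zero is a constant: its partial derivatives
vanish, by downward induction on the order of the derivative of the unknown. -/
theorem eq_C_of_totalDeriv_eq_zero {F : DiffPoly} (h : totalDeriv F = 0) :
    F = C (constantCoeff F) := by
  refine eq_C_of_pderiv_eq_zero ?_
  -- `F` involves only finitely many derivatives of the unknown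
  obtain ⟨N, hN⟩ : ∃ N, ∀ k, N ≤ k → pderiv k F = 0 := by
    refine ⟨F.vars.sup id + 1, fun k hk => pderiv_eq_zero_of_notMem_vars fun hmem => ?_⟩
    have : k ≤ F.vars.sup id := Finset.le_sup (f := id) hmem
    omega
  intro k
  have key : ∀ j i, i + j = N + k → pderiv i F = 0 := by
    intro j
    induction j with
    | zero => intro i hi; exact hN i (by omega)
    | succ j ih =>
      intro i hi
      have h1 := pderiv_succ_totalDeriv i F
      rwa [h, map_zero, ih (i + 1) (by omega), map_zero, zero_add, eq_comm] at h1
  exact key N k (by omega)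

theorem eq_of_totalDeriv_eq {F G : DiffPoly} (h : totalDeriv F = totalDeriv G)
    (h0 : constantCoeff F = constantCoeff G) : F = G := by
  have h1 := eq_C_of_totalDeriv_eq_zero (F := F - G) (by rw [map_sub, h, sub_self])
  rw [map_sub, h0, sub_self, C_0] at h1
  exact sub_eq_zero.1 h1

theorem constantCoeff_totalDeriv (F : DiffPoly) : constantCoeff (totalDeriv F) = 0 := by
  induction F using MvPolynomial.induction_on with
  | C a => rw [show totalDeriv (C a) = 0 from derivation_C totalDeriv a, map_zero]
  | add p q hp hq => rw [map_add, map_add, hp, hq, add_zero]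
  | mul_X p k hp =>
    rw [Derivation.leibniz, totalDeriv_X, map_add, smul_eq_mul, smul_eq_mul, map_mul, map_mul,
      constantCoeff_X, constantCoeff_X]
    simp

/-! ### Differential substitutions -/

/-- The substitution `u = P` of a differential polynomial for the unknown, `u⁽ᵏ⁾` being replaced
by the `k`-th total derivative of `P`. -/
noncomputable def diffSubst (P : DiffPoly) : DiffPoly →ₐ[ℚ] DiffPoly :=
  aeval fun k => totalDeriv^[k] P

theorem diffSubst_X (P : DiffPoly) (k : ℕ) : diffSubst P (X k) = totalDeriv^[k] P :=
  aeval_X _ _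

theorem diffSubst_totalDeriv (P F : DiffPoly) :
    diffSubst P (totalDeriv F) = totalDeriv (diffSubst P F) := by
  induction F using MvPolynomial.induction_on with
  | C a =>
    rw [show totalDeriv (C a) = 0 from derivation_C totalDeriv a, map_zero, diffSubst, aeval_C,
      Derivation.map_algebraMap]
  | add p q hp hq => simp only [map_add, hp, hq]
  | mul_X p k hp =>
    simp only [Derivation.leibniz, totalDeriv_X, map_add, smul_eq_mul, map_mul, hp, diffSubst_X,
      Function.iterate_succ_apply']

theorem constantCoeff_diffSubst {P : DiffPoly} (hP : constantCoeff P = 0) (F : DiffPoly) :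
    constantCoeff (diffSubst P F) = constantCoeff F := by
  induction F using MvPolynomial.induction_on with
  | C a => simp [diffSubst]
  | add p q hp hq => simp only [map_add, hp, hq]
  | mul_X p k hp =>
    have : constantCoeff (totalDeriv^[k] P) = 0 := by
      cases k with
      | zero => exact hP
      | succ k => rw [Function.iterate_succ_apply']; exact constantCoeff_totalDeriv _
    rw [map_mul, diffSubst_X, map_mul, this, map_mul, constantCoeff_X, mul_zero, mul_zero]

/-! ### The Miura transformation and the symmetry `w ↦ -w` -/

/-- The differential polynomial `w_z - w²` in `w`. -/
noncomputable def miuraPoly : DiffPoly := X 1 - X 0 ^ 2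

/-- The differential polynomial `-w_z - w²` in `w`, the Miura transform of `-w`. -/
noncomputable def miuraNegPoly : DiffPoly := -X 1 - X 0 ^ 2

theorem constantCoeff_miuraPoly : constantCoeff miuraPoly = 0 := by simp [miuraPoly]

theorem constantCoeff_miuraNegPoly : constantCoeff miuraNegPoly = 0 := by simp [miuraNegPoly]

/-- The Lenard operator at a Miura transform factors:
`d³ + 4 u d + 2 u_z = (d - 2 w) d (d + 2 w)` for `u = w_z - w²`. -/
theorem totalDeriv_miura_lenard_succ (k : ℕ) :
    totalDeriv (diffSubst miuraPoly (lenard (k + 1))) =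
      totalDeriv (totalDeriv (totalDeriv (diffSubst miuraPoly (lenard k))
        + 2 * X 0 * diffSubst miuraPoly (lenard k)))
      - 2 * X 0 * totalDeriv (totalDeriv (diffSubst miuraPoly (lenard k))
        + 2 * X 0 * diffSubst miuraPoly (lenard k)) := by
  have h2 : totalDeriv (2 : DiffPoly) = 0 := by exact_mod_cast totalDeriv.map_natCast 2
  have e4 : diffSubst miuraPoly 4 = 4 := map_ofNat _ 4
  have e2 : diffSubst miuraPoly 2 = 2 := map_ofNat _ 2
  have hX0 : diffSubst miuraPoly (X 0) = X 1 - X 0 ^ 2 := diffSubst_X _ 0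
  have hX1 : diffSubst miuraPoly (X 1) = X 2 - 2 * X 0 * X 1 := by
    rw [← totalDeriv_X 0, diffSubst_totalDeriv, hX0]
    simp only [map_sub, pow_two, Derivation.leibniz, smul_eq_mul, totalDeriv_X]
    ring
  rw [← diffSubst_totalDeriv, (lenard_spec k).1, lenardOp]
  simp only [map_add, map_mul, diffSubst_totalDeriv, hX0, hX1, e4, e2, Derivation.leibniz,
    smul_eq_mul, totalDeriv_X, h2, map_zero]
  ring

/-- The factorization of the Lenard operator for `-w`:
`d³ + 4 u d + 2 u_z = (d + 2 w) d (d - 2 w)` for `u = -w_z - w²`. -/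
theorem totalDeriv_miuraNeg_lenard_succ (k : ℕ) :
    totalDeriv (diffSubst miuraNegPoly (lenard (k + 1))) =
      totalDeriv (totalDeriv (totalDeriv (diffSubst miuraNegPoly (lenard k))
        - 2 * X 0 * diffSubst miuraNegPoly (lenard k)))
      + 2 * X 0 * totalDeriv (totalDeriv (diffSubst miuraNegPoly (lenard k))
        - 2 * X 0 * diffSubst miuraNegPoly (lenard k)) := by
  have h2 : totalDeriv (2 : DiffPoly) = 0 := by exact_mod_cast totalDeriv.map_natCast 2
  have e4 : diffSubst miuraNegPoly 4 = 4 := map_ofNat _ 4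
  have e2 : diffSubst miuraNegPoly 2 = 2 := map_ofNat _ 2
  have hX0 : diffSubst miuraNegPoly (X 0) = -X 1 - X 0 ^ 2 := diffSubst_X _ 0
  have hX1 : diffSubst miuraNegPoly (X 1) = -X 2 - 2 * X 0 * X 1 := by
    rw [← totalDeriv_X 0, diffSubst_totalDeriv, hX0]
    simp only [map_sub, map_neg, pow_two, Derivation.leibniz, smul_eq_mul, totalDeriv_X]
    ring
  rw [← diffSubst_totalDeriv, (lenard_spec k).1, lenardOp]
  simp only [map_add, map_sub, map_mul, diffSubst_totalDeriv, hX0, hX1, e4, e2,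
    Derivation.leibniz, smul_eq_mul, totalDeriv_X, h2, map_zero]
  ring

theorem lenard_zero : lenard 0 = C (1 / 2) := by rw [lenard]

/-- The differential polynomial `(d/dz + 2 w) 𝓛_k[w_z - w²]` in `w`. -/
noncomputable def shiftPoly (k : ℕ) : DiffPoly :=
  totalDeriv (diffSubst miuraPoly (lenard k)) + 2 * X 0 * diffSubst miuraPoly (lenard k)

/-- The differential polynomial `(d/dz - 2 w) 𝓛_k[-w_z - w²]` in `w`, i.e. `shiftPoly k` at
`-w`. -/
noncomputable def shiftNegPoly (k : ℕ) : DiffPoly :=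
  totalDeriv (diffSubst miuraNegPoly (lenard k)) - 2 * X 0 * diffSubst miuraNegPoly (lenard k)

theorem diffSubst_lenard_zero (P : DiffPoly) : diffSubst P (lenard 0) = C (1 / 2) := by
  rw [lenard_zero, diffSubst, aeval_C, algebraMap_eq]

/-- One step of the induction for `shiftNegPoly_eq`: by the two factorizations both sides have
the same total derivative. -/
theorem miuraNeg_lenard_succ_of_shift {k : ℕ} (h : shiftNegPoly k = -shiftPoly k) :
    diffSubst miuraNegPoly (lenard (k + 1)) =
      diffSubst miuraPoly (lenard (k + 1)) - 2 * totalDeriv (shiftPoly k) := by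
  have h2 : totalDeriv (2 : DiffPoly) = 0 := by exact_mod_cast totalDeriv.map_natCast 2
  refine eq_of_totalDeriv_eq ?_ ?_
  · have e1 := totalDeriv_miura_lenard_succ k
    have e2 := totalDeriv_miuraNeg_lenard_succ k
    rw [← shiftPoly] at e1
    rw [← shiftNegPoly, h, map_neg, map_neg] at e2
    rw [map_sub, Derivation.leibniz, h2, e1, e2, smul_eq_mul, smul_zero]
    ring
  · rw [map_sub, map_mul, constantCoeff_totalDeriv,
      constantCoeff_diffSubst constantCoeff_miuraPoly,
      constantCoeff_diffSubst constantCoeff_miuraNegPoly, mul_zero, sub_zero]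

/-- `𝓥_k` is odd in `w`. -/
theorem shiftNegPoly_eq (k : ℕ) : shiftNegPoly k = -shiftPoly k := by
  have hC : totalDeriv (C (1 / 2)) = 0 := derivation_C totalDeriv _
  induction k with
  | zero =>
    rw [shiftNegPoly, shiftPoly, diffSubst_lenard_zero, diffSubst_lenard_zero, hC]
    ring
  | succ k ih =>
    have e := miuraNeg_lenard_succ_of_shift ih
    have e1 := totalDeriv_miura_lenard_succ k
    have e2 := totalDeriv_miuraNeg_lenard_succ k
    rw [← shiftPoly] at e1
    rw [← shiftNegPoly, ih, map_neg, map_neg] at e2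
    rw [shiftNegPoly, shiftPoly, e2, e1, e]
    ring

/-- `𝓛_{k+1}[-w_z - w²] = 𝓛_{k+1}[w_z - w²] - 2 d/dz 𝓥_k`. -/
theorem miuraNeg_lenard_succ (k : ℕ) :
    diffSubst miuraNegPoly (lenard (k + 1)) =
      diffSubst miuraPoly (lenard (k + 1)) - 2 * totalDeriv (shiftPoly k) :=
  miuraNeg_lenard_succ_of_shift (shiftNegPoly_eq k)

/-! ### Power sums and the top elementary symmetric polynomial -/

/-- The polynomial of `Π_1, …, Π_{2n}` that gives the `k`-th elementary symmetric polynomial. -/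
noncomputable def elemSymmPoly (n k : ℕ) : MvPolynomial (Fin (2 * n)) ℚ :=
  (esymmAlgEquiv (Fin (2 * n)) ℚ (Fintype.card_fin (2 * n))).symm
    ⟨esymm (Fin (2 * n)) ℚ k, esymm_isSymmetric (Fin (2 * n)) ℚ k⟩

theorem elemSymmPoly_succ (n : ℕ) (i : Fin (2 * n)) : elemSymmPoly n (i + 1) = X i :=
  esymmAlgEquiv_symm_apply _ _ i

/-- Newton's identities, as relations between polynomials in `Π_1, …, Π_{2n}`. -/
theorem powerSum_eq (n : ℕ) {k : ℕ} (hk : 0 < k) :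
    powerSum n k = (-1) ^ (k + 1) * k * elemSymmPoly n k -
      ∑ a ∈ Finset.HasAntidiagonal.antidiagonal k with a.1 ∈ Set.Ioo 0 k,
        (-1) ^ a.1 * elemSymmPoly n a.1 * powerSum n a.2 := by
  let e := esymmAlgEquiv (Fin (2 * n)) ℚ (Fintype.card_fin (2 * n))
  let φ := (symmetricSubalgebra (Fin (2 * n)) ℚ).val.comp e.toAlgHom
  have hφ : Function.Injective φ := Subtype.val_injective.comp e.injective
  have h1 : ∀ j, φ (powerSum n j) = psum (Fin (2 * n)) ℚ j := fun j =>
    congrArg Subtype.val (e.apply_symm_apply _)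
  have h2 : ∀ j, φ (elemSymmPoly n j) = esymm (Fin (2 * n)) ℚ j := fun j =>
    congrArg Subtype.val (e.apply_symm_apply _)
  apply hφ
  rw [map_sub, map_sum]
  simp only [map_mul, map_pow, map_neg, map_one, map_natCast, h1, h2]
  exact psum_eq_mul_esymm_sub_sum (Fin (2 * n)) ℚ k hk

/-- Among `S_1, …, S_{2n}` only `S_{2n}` involves `Π_{2n}`, and `∂S_{2n}/∂Π_{2n} = -2n`. -/
theorem pderiv_last_powerSum {n : ℕ} (i : Fin (2 * n)) (hi : (i : ℕ) + 1 = 2 * n) {k : ℕ}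
    (hk : 0 < k) (hkn : k ≤ 2 * n) :
    pderiv i (powerSum n k) = if k = 2 * n then -(2 * n : MvPolynomial (Fin (2 * n)) ℚ) else 0 := by
  have hE : ∀ j, 0 < j → j ≤ 2 * n → pderiv i (elemSymmPoly n j) = if j = 2 * n then 1 else 0 := by
    intro j hj hjn
    have := elemSymmPoly_succ n ⟨j - 1, by omega⟩
    simp only [Nat.sub_add_cancel hj] at this
    rw [this]
    split_ifs with h
    · rw [show (⟨j - 1, by omega⟩ : Fin (2 * n)) = i from Fin.ext (by simp; omega), pderiv_X_self]
    · refine pderiv_X_of_ne fun h' => h ?_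
      rw [← h'] at hi
      simp only at hi
      omega
  have hconst : ∀ (m l : ℕ), pderiv i ((-1) ^ m * l : MvPolynomial (Fin (2 * n)) ℚ) = 0 := by
    intro m l
    rw [show ((-1) ^ m * l : MvPolynomial (Fin (2 * n)) ℚ) = C ((-1) ^ m * (l : ℚ)) by simp]
    exact pderiv_C
  induction k using Nat.strong_induction_on with
  | _ k ih =>
    rw [powerSum_eq n hk, map_sub, map_sum, Finset.sum_eq_zero, sub_zero, pderiv_mul, hconst,
      hE k hk hkn]
    · split_ifs with h
      · rw [h, Odd.neg_one_pow ⟨n, rfl⟩]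
        push_cast
        ring
      · ring
    · rintro ⟨a, b⟩ hab
      simp only [Finset.mem_filter, Finset.HasAntidiagonal.mem_antidiagonal, Set.mem_Ioo] at hab
      have h1 := hconst a 1
      rw [Nat.cast_one, mul_one] at h1
      rw [pderiv_mul, pderiv_mul, h1, hE a (by omega) (by omega), ih b (by omega) (by omega)
        (by omega), if_neg (by omega), if_neg (by omega)]
      ring

variable {𝕜 : Type*} [RCLike 𝕜]

/-! ### Evaluation of differential polynomials at smooth functions -/

theorem hasDerivAt_of_contDiffOn {U : Set 𝕜} (hU : IsOpen U) {f : 𝕜 → 𝕜}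
    (hf : ContDiffOn 𝕜 ∞ f U) {z : 𝕜} (hz : z ∈ U) : HasDerivAt f (deriv f z) z :=
  ((hf.differentiableOn (by simp)).differentiableAt (hU.mem_nhds hz)).hasDerivAt

theorem contDiffOn_deriv {U : Set 𝕜} (hU : IsOpen U) {f : 𝕜 → 𝕜}
    (hf : ContDiffOn 𝕜 ∞ f U) : ContDiffOn 𝕜 ∞ (deriv f) U :=
  ((contDiffOn_infty_iff_deriv_of_isOpen hU).1 hf).2

theorem contDiffOn_iteratedDeriv {U : Set 𝕜} (hU : IsOpen U) {f : 𝕜 → 𝕜}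
    (hf : ContDiffOn 𝕜 ∞ f U) (k : ℕ) : ContDiffOn 𝕜 ∞ (iteratedDeriv k f) U := by
  induction k with
  | zero => simpa using hf
  | succ k ih => rw [iteratedDeriv_succ]; exact contDiffOn_deriv hU ih

theorem contDiffOn_miura {U : Set 𝕜} (hU : IsOpen U) {w : 𝕜 → 𝕜}
    (hw : ContDiffOn 𝕜 ∞ w U) : ContDiffOn 𝕜 ∞ (miura w) U :=
  (contDiffOn_deriv hU hw).sub (hw.pow 2)

theorem evalDiff_X (k : ℕ) (u : 𝕜 → 𝕜) (z : 𝕜) : evalDiff (X k) u z = iteratedDeriv k u z :=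
  aeval_X _ _

theorem evalDiff_add (F G : DiffPoly) (u : 𝕜 → 𝕜) (z : 𝕜) :
    evalDiff (F + G) u z = evalDiff F u z + evalDiff G u z := map_add _ F G

theorem evalDiff_sub (F G : DiffPoly) (u : 𝕜 → 𝕜) (z : 𝕜) :
    evalDiff (F - G) u z = evalDiff F u z - evalDiff G u z := map_sub _ F G

theorem evalDiff_neg (F : DiffPoly) (u : 𝕜 → 𝕜) (z : 𝕜) :
    evalDiff (-F) u z = -evalDiff F u z := map_neg _ F

theorem evalDiff_mul (F G : DiffPoly) (u : 𝕜 → 𝕜) (z : 𝕜) :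
    evalDiff (F * G) u z = evalDiff F u z * evalDiff G u z := map_mul _ F G

theorem evalDiff_two (u : 𝕜 → 𝕜) (z : 𝕜) : evalDiff 2 u z = 2 := map_ofNat _ 2

theorem contDiffOn_evalDiff {U : Set 𝕜} (hU : IsOpen U) {u : 𝕜 → 𝕜}
    (hu : ContDiffOn 𝕜 ∞ u U) (F : DiffPoly) : ContDiffOn 𝕜 ∞ (evalDiff F u) U := by
  induction F using MvPolynomial.induction_on with
  | C a =>
    refine (contDiffOn_const (c := algebraMap ℚ 𝕜 a)).congr fun z _ => ?_
    rw [evalDiff, aeval_C]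
  | add p q hp hq => exact (hp.add hq).congr fun z _ => evalDiff_add p q u z
  | mul_X p k hp =>
    refine (hp.mul (contDiffOn_iteratedDeriv hU hu k)).congr fun z _ => ?_
    rw [evalDiff_mul, evalDiff_X]

/-- On an open set where `u` is smooth, the total derivative of a differential polynomial
evaluates to the derivative of its value. -/
theorem hasDerivAt_evalDiff {U : Set 𝕜} (hU : IsOpen U) {u : 𝕜 → 𝕜}
    (hu : ContDiffOn 𝕜 ∞ u U) (F : DiffPoly) {z : 𝕜} (hz : z ∈ U) :
    HasDerivAt (evalDiff F u) (evalDiff (totalDeriv F) u z) z := by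
  induction F using MvPolynomial.induction_on with
  | C a =>
    have h1 : evalDiff (C a) u = fun _ : 𝕜 => algebraMap ℚ 𝕜 a :=
      funext fun z => by rw [evalDiff, aeval_C]
    rw [show totalDeriv (C a) = 0 from derivation_C totalDeriv a, h1, evalDiff, map_zero]
    exact hasDerivAt_const _ _
  | add p q hp hq =>
    rw [map_add, evalDiff_add]
    have h1 : evalDiff (p + q) u = fun z => evalDiff p u z + evalDiff q u z :=
      funext fun z => evalDiff_add p q u z
    rw [h1]
    exact hp.add hq
  | mul_X p k hp =>
    have h1 : evalDiff (p * X k) u = fun z => evalDiff p u z * iteratedDeriv k u z :=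
      funext fun z => by rw [evalDiff_mul, evalDiff_X]
    have h2 := hasDerivAt_of_contDiffOn hU (contDiffOn_iteratedDeriv hU hu k) hz
    rw [← iteratedDeriv_succ] at h2
    rw [h1, Derivation.leibniz, evalDiff_add, smul_eq_mul, smul_eq_mul, evalDiff_mul,
      evalDiff_mul, totalDeriv_X, evalDiff_X, evalDiff_X]
    refine (hp.mul h2).congr_deriv ?_
    ring

theorem deriv_evalDiff {U : Set 𝕜} (hU : IsOpen U) {u : 𝕜 → 𝕜}
    (hu : ContDiffOn 𝕜 ∞ u U) (F : DiffPoly) {z : 𝕜} (hz : z ∈ U) :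
    deriv (evalDiff F u) z = evalDiff (totalDeriv F) u z :=
  (hasDerivAt_evalDiff hU hu F hz).deriv

theorem evalDiff_congr {U : Set 𝕜} (hU : IsOpen U) {u v : 𝕜 → 𝕜} (h : Set.EqOn u v U)
    (F : DiffPoly) {z : 𝕜} (hz : z ∈ U) : evalDiff F u z = evalDiff F v z := by
  rw [evalDiff, evalDiff]
  congr 2
  funext k
  exact h.iteratedDeriv_of_isOpen hU k hz

/-- Evaluating at `w` after the substitution `u = P` is evaluating at the function `P[w]`. -/
theorem evalDiff_diffSubst {U : Set 𝕜} (hU : IsOpen U) {w u : 𝕜 → 𝕜}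
    (hw : ContDiffOn 𝕜 ∞ w U) {P : DiffPoly} (hP : Set.EqOn u (evalDiff P w) U)
    (F : DiffPoly) {z : 𝕜} (hz : z ∈ U) : evalDiff (diffSubst P F) w z = evalDiff F u z := by
  have key : ∀ k, Set.EqOn (iteratedDeriv k u) (evalDiff (totalDeriv^[k] P) w) U := by
    intro k
    induction k with
    | zero => simpa using hP
    | succ k ih =>
      intro y hy
      rw [iteratedDeriv_succ, ih.deriv hU hy, deriv_evalDiff hU hw _ hy,
        Function.iterate_succ_apply']
  induction F using MvPolynomial.induction_on with
  | C a => rw [diffSubst, aeval_C, algebraMap_eq, evalDiff, evalDiff, aeval_C, aeval_C]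
  | add p q hp hq => rw [map_add, evalDiff_add, evalDiff_add, hp, hq]
  | mul_X p k hp =>
    rw [map_mul, evalDiff_mul, evalDiff_mul, hp, diffSubst_X, evalDiff_X, key k hz]

/-! ### The functions `𝓛_k` and `𝓥_k` -/

theorem contDiffOn_lenardAt {U : Set 𝕜} (hU : IsOpen U) {w : 𝕜 → 𝕜}
    (hw : ContDiffOn 𝕜 ∞ w U) (k : ℕ) : ContDiffOn 𝕜 ∞ (lenardAt k w) U :=
  contDiffOn_evalDiff hU (contDiffOn_miura hU hw) _

theorem contDiffOn_lenardShift {U : Set 𝕜} (hU : IsOpen U) {w : 𝕜 → 𝕜}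
    (hw : ContDiffOn 𝕜 ∞ w U) (k : ℕ) : ContDiffOn 𝕜 ∞ (lenardShift k w) U :=
  (contDiffOn_deriv hU (contDiffOn_lenardAt hU hw k)).add
    ((contDiffOn_const.mul hw).mul (contDiffOn_lenardAt hU hw k))

theorem lenardAt_zero (w : 𝕜 → 𝕜) (z : 𝕜) : lenardAt 0 w z = 1 / 2 := by
  rw [lenardAt, lenard_zero, evalDiff, aeval_C]
  simp

theorem lenardShift_zero (w : 𝕜 → 𝕜) (z : 𝕜) : lenardShift 0 w z = w z := by
  have h : lenardAt 0 w = fun _ => (1 / 2 : 𝕜) := funext (lenardAt_zero w)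
  rw [lenardShift, h, deriv_const]
  ring

theorem miura_eq_evalDiff (w : 𝕜 → 𝕜) : miura w = evalDiff miuraPoly w := by
  funext z
  rw [miuraPoly, pow_two, evalDiff_sub, evalDiff_mul, evalDiff_X, evalDiff_X, iteratedDeriv_one,
    iteratedDeriv_zero, miura, pow_two]

theorem miura_neg_eq_evalDiff (w : 𝕜 → 𝕜) :
    miura (fun z => -w z) = evalDiff miuraNegPoly w := by
  funext z
  rw [miuraNegPoly, pow_two, evalDiff_sub, evalDiff_neg, evalDiff_mul, evalDiff_X, evalDiff_X,
    iteratedDeriv_one, iteratedDeriv_zero, miura, deriv.fun_neg, neg_sq, pow_two]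

theorem eqOn_lenardAt {U : Set 𝕜} (hU : IsOpen U) {w : 𝕜 → 𝕜} (hw : ContDiffOn 𝕜 ∞ w U)
    (k : ℕ) : Set.EqOn (lenardAt k w) (evalDiff (diffSubst miuraPoly (lenard k)) w) U :=
  fun _ hz => (evalDiff_diffSubst hU hw (fun _ _ => congrFun (miura_eq_evalDiff w) _) _ hz).symm

theorem eqOn_lenardAt_neg {U : Set 𝕜} (hU : IsOpen U) {w : 𝕜 → 𝕜} (hw : ContDiffOn 𝕜 ∞ w U)
    (k : ℕ) : Set.EqOn (lenardAt k fun z => -w z)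
      (evalDiff (diffSubst miuraNegPoly (lenard k)) w) U :=
  fun _ hz =>
    (evalDiff_diffSubst hU hw (fun _ _ => congrFun (miura_neg_eq_evalDiff w) _) _ hz).symm

theorem eqOn_lenardShift {U : Set 𝕜} (hU : IsOpen U) {w : 𝕜 → 𝕜} (hw : ContDiffOn 𝕜 ∞ w U)
    (k : ℕ) : Set.EqOn (lenardShift k w) (evalDiff (shiftPoly k) w) U := by
  intro z hz
  rw [lenardShift, (eqOn_lenardAt hU hw k).deriv hU hz, deriv_evalDiff hU hw _ hz,
    eqOn_lenardAt hU hw k hz, shiftPoly, evalDiff_add, evalDiff_mul, evalDiff_mul, evalDiff_two,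
    evalDiff_X, iteratedDeriv_zero]

theorem lenardShift_neg {U : Set 𝕜} (hU : IsOpen U) {w : 𝕜 → 𝕜} (hw : ContDiffOn 𝕜 ∞ w U)
    (k : ℕ) : Set.EqOn (lenardShift k fun z => -w z) (fun z => -lenardShift k w z) U := by
  intro z hz
  have h : lenardShift k (fun z => -w z) z = evalDiff (shiftNegPoly k) w z := by
    rw [lenardShift, (eqOn_lenardAt_neg hU hw k).deriv hU hz, deriv_evalDiff hU hw _ hz,
      eqOn_lenardAt_neg hU hw k hz, shiftNegPoly, evalDiff_sub, evalDiff_mul, evalDiff_mul,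
      evalDiff_two, evalDiff_X, iteratedDeriv_zero]
    ring
  rw [h, shiftNegPoly_eq, evalDiff_neg, ← eqOn_lenardShift hU hw k hz]

theorem deriv_lenardShift_neg {U : Set 𝕜} (hU : IsOpen U) {w : 𝕜 → 𝕜}
    (hw : ContDiffOn 𝕜 ∞ w U) (k : ℕ) {z : 𝕜} (hz : z ∈ U) :
    deriv (lenardShift k fun z => -w z) z = -deriv (lenardShift k w) z := by
  rw [(lenardShift_neg hU hw k).deriv hU hz, deriv.fun_neg]

/-- The change of `𝓛_{k+1}` under `w ↦ -w`. -/
theorem lenardAt_neg_succ {U : Set 𝕜} (hU : IsOpen U) {w : 𝕜 → 𝕜} (hw : ContDiffOn 𝕜 ∞ w U)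
    (k : ℕ) {z : 𝕜} (hz : z ∈ U) :
    lenardAt (k + 1) (fun z => -w z) z =
      lenardAt (k + 1) w z - 2 * deriv (lenardShift k w) z := by
  rw [eqOn_lenardAt_neg hU hw _ hz, miuraNeg_lenard_succ, evalDiff_sub, evalDiff_mul,
    evalDiff_two, ← eqOn_lenardAt hU hw _ hz, (eqOn_lenardShift hU hw k).deriv hU hz,
    deriv_evalDiff hU hw _ hz]

/-! ### The canonical coordinate `Q_n` -/

/-- `Q_n = -b_{2n}`: only the term `j = n` of the sum contributes. -/
theorem coordQ_last {n : ℕ} (hn : 1 ≤ n) (t : ℕ → 𝕜) (α : 𝕜) (w : 𝕜 → 𝕜) (z : 𝕜) :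
    coordQ n t α w ⟨n - 1, by omega⟩ z = -coeffBeven n t α w n z := by
  have hn0 : (n : 𝕜) ≠ 0 := Nat.cast_ne_zero.2 (by omega)
  rw [coordQ, Finset.sum_eq_single_of_mem n (by simp [hn])]
  · rw [pderiv_last_powerSum _ (by simp only; omega) (by omega) le_rfl, if_pos rfl]
    rw [map_neg, map_mul, map_natCast, show aeval (elemSymm n t w z) (2 : MvPolynomial _ ℚ) = 2
      from map_ofNat _ 2]
    field_simp
  · intro j hj hjn
    rw [Finset.mem_Icc] at hj
    rw [pderiv_last_powerSum _ (by simp only; omega) (by omega) (by omega), if_neg (by omega),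
      map_zero, mul_zero]

theorem coeffBeven_last {n : ℕ} (hn : 1 ≤ n) (t : ℕ → 𝕜) (α : 𝕜) (w : 𝕜 → 𝕜) (z : 𝕜) :
    coeffBeven n t α w n z = -4 ^ n * w z := by
  rw [coeffBeven, if_neg (by omega), Finset.sum_eq_single_of_mem n (by simp [hn])]
  · rw [time, if_neg (by omega), if_pos rfl, entryBeven, if_pos ⟨hn, le_rfl⟩, Nat.sub_self,
      lenardShift_zero, one_mul]
  · intro l hl hln
    rw [Finset.mem_Icc] at hl
    rw [entryBeven, if_neg (by omega), mul_zero]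

/-! ### The generator `r` -/

section Negation

variable {n : ℕ} {t : ℕ → 𝕜} {α : 𝕜} {U : Set 𝕜} {w : 𝕜 → 𝕜}

theorem coeffA_neg (hU : IsOpen U) (hw : ContDiffOn 𝕜 ∞ w U) (k : ℕ) {z : 𝕜} (hz : z ∈ U) :
    coeffA n t (fun x => -w x) k z = coeffA n t w k z := by
  rw [coeffA, coeffA]
  congr 1
  refine Finset.sum_congr rfl fun l _ => ?_
  rw [entryA, entryA]
  congr 1
  split_ifs with h1 h2
  · rfl
  · obtain ⟨m, rfl⟩ := Nat.exists_eq_add_of_lt h2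
    rw [show k + m + 1 - k - 1 = m by omega, show k + m + 1 - k = m + 1 by omega,
      lenardAt_neg_succ hU hw m hz, deriv_lenardShift_neg hU hw m hz]
    ring
  · rfl

theorem coeffBodd_neg (hU : IsOpen U) (hw : ContDiffOn 𝕜 ∞ w U) (k : ℕ) {z : 𝕜} (hz : z ∈ U) :
    coeffBodd n t (fun x => -w x) k z = -coeffBodd n t w k z := by
  rw [coeffBodd, coeffBodd, ← Finset.sum_neg_distrib]
  refine Finset.sum_congr rfl fun l _ => ?_
  rw [entryBodd, entryBodd, deriv_lenardShift_neg hU hw _ hz]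
  split_ifs <;> ring

theorem coeffBeven_neg (hU : IsOpen U) (hw : ContDiffOn 𝕜 ∞ w U) (k : ℕ) {z : 𝕜} (hz : z ∈ U) :
    coeffBeven n t (-α) (fun x => -w x) k z = -coeffBeven n t α w k z := by
  rw [coeffBeven, coeffBeven]
  split_ifs with h
  · rfl
  rw [← Finset.sum_neg_distrib]
  refine Finset.sum_congr rfl fun l _ => ?_
  rw [entryBeven, entryBeven, lenardShift_neg hU hw _ hz]
  split_ifs <;> ring

theorem IsSolution.neg (hU : IsOpen U) (hw : IsSolution n t α U w) :
    IsSolution n t (-α) U fun z => -w z := by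
  refine ⟨hw.1.neg, fun z hz => ?_⟩
  have h := hw.2 z hz
  rw [lenardShift_neg hU hw.1 n hz, Finset.sum_congr rfl fun l _ =>
    show t l * lenardShift l (fun z => -w z) z = -(t l * lenardShift l w z) by
      rw [lenardShift_neg hU hw.1 l hz]; ring, Finset.sum_neg_distrib]
  linear_combination -h

theorem sigma_neg (hn : 1 ≤ n) (hU : IsOpen U) (hw : ContDiffOn 𝕜 ∞ w U) {z : 𝕜} (hz : z ∈ U) :
    sigma n hn t (-α) (fun x => -w x) z = sigma n hn t α w z - 2 * w z := by
  rw [sigma, sigma, coordQ_last hn, coordQ_last hn]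
  simp only [coeffA_neg hU hw _ hz, coeffBodd_neg hU hw _ hz, coeffBeven_neg hU hw _ hz,
    neg_mul_neg]
  rw [coeffBeven_last hn]
  field_simp
  ring

end Negation

/-! ### The Hamiltonian in terms of `u = w_z - w²` -/

section Reduction

variable {K : Type*} [Field K]

theorem sum_range_mul_reflect (f g : ℕ → K) (n : ℕ) :
    ∑ l ∈ Finset.range n, f l * g (n - l - 1) = ∑ l ∈ Finset.range n, g l * f (n - l - 1) := by
  rw [← Finset.sum_range_reflect]
  refine Finset.sum_congr rfl fun l hl => ?_
  rw [Finset.mem_range] at hl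
  rw [show n - (n - 1 - l) - 1 = l by omega, show n - 1 - l = n - l - 1 by omega, mul_comm]

theorem sum_range_succ_mul_reflect (f g : ℕ → K) (n : ℕ) :
    ∑ l ∈ Finset.range (n + 1), f l * g (n - l) = ∑ l ∈ Finset.range (n + 1), g l * f (n - l) := by
  have h := sum_range_mul_reflect f g (n + 1)
  simpa only [show ∀ l, n + 1 - l - 1 = n - l from fun l => by omega] using h

/-- The quadratic form of the Hamiltonian, for sequences `e`, `e1`, `e2` in the role of the
values of functions `ℓ_k` and of their first two derivatives, `s k` and `s1 k` being the values of
`(d/dz + 2 w) ℓ_k` and its derivative, and `w1` that of `w_z`. The result depends on `w` and `w1`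
only through `w1 - w²`. -/
theorem hamiltonian_reduction (n : ℕ) (hn : 1 ≤ n) (h2 : (2 : K) ≠ 0) (w w1 : K)
    (e e1 e2 s s1 a b c : ℕ → K)
    (hs : ∀ k, s k = e1 k + 2 * w * e k)
    (hs1 : ∀ k, s1 k = e2 k + 2 * w1 * e k + 2 * w * e1 k)
    (hs10 : s1 0 = 0)
    (ha : ∀ k < n, a k = 4 ^ (k + 1) / 2 * (e k - s1 (k + 1)))
    (hb : ∀ k < n, b k = 4 ^ (k + 1) / 2 * s1 (k + 1))
    (hc : ∀ k ≤ n, c k = -4 ^ k * (s k + if k = 0 then 1 / 2 else 0)) :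
    ∑ l ∈ Finset.range n, a l * a (n - l - 1) - ∑ l ∈ Finset.range n, b l * b (n - l - 1)
        + ∑ l ∈ Finset.range (n + 1), c l * c (n - l) =
      4 ^ n * (∑ l ∈ Finset.range n, e l * e (n - l - 1)
        + ∑ l ∈ Finset.range (n + 1), (e1 l * e1 (n - l) - 2 * (e l * e2 (n - l))
          - 4 * (w1 - w ^ 2) * (e l * e (n - l))) + s n) := by
  have h4 : (4 : K) = 2 * 2 := by norm_num
  have odd : ∑ l ∈ Finset.range n, a l * a (n - l - 1)
      - ∑ l ∈ Finset.range n, b l * b (n - l - 1) =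
      4 ^ n * (∑ l ∈ Finset.range n, e l * e (n - l - 1)
        - 2 * ∑ l ∈ Finset.range n, e l * s1 (n - l)) := by
    have hrefl : ∑ l ∈ Finset.range n, e l * s1 (n - l) =
        ∑ l ∈ Finset.range n, s1 (l + 1) * e (n - l - 1) := by
      rw [← sum_range_mul_reflect e (fun k => s1 (k + 1))]
      refine Finset.sum_congr rfl fun l hl => ?_
      rw [Finset.mem_range] at hl
      rw [show n - l - 1 + 1 = n - l by omega]
    rw [two_mul, ← sub_sub]
    nth_rewrite 2 [hrefl]
    rw [← Finset.sum_sub_distrib, ← Finset.sum_sub_distrib, ← Finset.sum_sub_distrib,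
      Finset.mul_sum]
    refine Finset.sum_congr rfl fun l hl => ?_
    rw [Finset.mem_range] at hl
    obtain ⟨m, rfl⟩ : ∃ m, n = l + m + 1 := ⟨n - l - 1, by omega⟩
    rw [show l + m + 1 - l - 1 = m by omega, show l + m + 1 - l = m + 1 by omega,
      ha l (by omega), ha m (by omega), hb l (by omega), hb m (by omega), h4]
    field_simp
    ring
  -- the correction `1/2` at `k = 0` enters once from each end of the sum and adds `s n`
  have even : ∑ l ∈ Finset.range (n + 1), c l * c (n - l) =
      4 ^ n * (∑ l ∈ Finset.range (n + 1), s l * s (n - l) + s n) := by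
    have hδ : ∑ l ∈ Finset.range (n + 1), s l * (if n - l = 0 then 1 / 2 else 0) =
        ∑ l ∈ Finset.range (n + 1), (if l = 0 then 1 / 2 else 0) * s (n - l) :=
      sum_range_succ_mul_reflect s (fun k => if k = 0 then 1 / 2 else 0) n
    have hδ' : ∑ l ∈ Finset.range (n + 1), (if l = 0 then 1 / 2 else 0) * s (n - l) =
        1 / 2 * s n := by
      rw [Finset.sum_eq_single_of_mem 0 (by simp) (fun l _ hl => by rw [if_neg hl, zero_mul])]
      simp
    have : s n = ∑ l ∈ Finset.range (n + 1), s l * (if n - l = 0 then 1 / 2 else 0)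
        + ∑ l ∈ Finset.range (n + 1), (if l = 0 then 1 / 2 else 0) * s (n - l) := by
      rw [hδ, hδ']
      field_simp
      ring
    rw [this, ← Finset.sum_add_distrib, ← Finset.sum_add_distrib, Finset.mul_sum]
    refine Finset.sum_congr rfl fun l hl => ?_
    rw [Finset.mem_range] at hl
    obtain ⟨m, rfl⟩ : ∃ m, n = l + m := ⟨n - l, by omega⟩
    rw [show l + m - l = m by omega, hc l (by omega), hc m (by omega)]
    have : (if l = 0 then 1 / 2 else 0) * (if m = 0 then 1 / 2 else 0) = (0 : K) := by
      rcases Nat.eq_zero_or_pos l with h | h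
      · rw [if_neg (show ¬ m = 0 by omega), mul_zero]
      · rw [if_neg (show ¬ l = 0 by omega), zero_mul]
    linear_combination 4 ^ (l + m) * this
  -- the term `l = n` may be added because `s1 0 = 0`
  have ext : ∑ l ∈ Finset.range n, e l * s1 (n - l) =
      ∑ l ∈ Finset.range (n + 1), e l * s1 (n - l) := by
    rw [Finset.sum_range_succ, Nat.sub_self, hs10, mul_zero, add_zero]
  -- the terms linear in `w` cancel after reversing the order of summation
  have quad : ∑ l ∈ Finset.range (n + 1), s l * s (n - l)
      - 2 * ∑ l ∈ Finset.range (n + 1), e l * s1 (n - l) =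
      ∑ l ∈ Finset.range (n + 1), (e1 l * e1 (n - l) - 2 * (e l * e2 (n - l))
          - 4 * (w1 - w ^ 2) * (e l * e (n - l))) := by
    have hrefl := sum_range_succ_mul_reflect e e1 n
    have : ∑ l ∈ Finset.range (n + 1), (e1 l * e1 (n - l) - 2 * (e l * e2 (n - l))
          - 4 * (w1 - w ^ 2) * (e l * e (n - l))) =
        ∑ l ∈ Finset.range (n + 1), (e1 l * e1 (n - l) - 2 * (e l * e2 (n - l))
          - 4 * (w1 - w ^ 2) * (e l * e (n - l)))
        + 2 * w * (∑ l ∈ Finset.range (n + 1), e1 l * e (n - l)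
          - ∑ l ∈ Finset.range (n + 1), e l * e1 (n - l)) := by
      rw [hrefl]
      ring
    rw [this, ← Finset.sum_sub_distrib, Finset.mul_sum, Finset.mul_sum, ← Finset.sum_add_distrib,
      ← Finset.sum_sub_distrib]
    refine Finset.sum_congr rfl fun l _ => ?_
    rw [hs, hs, hs1]
    ring
  rw [odd, even, ← quad, ext]
  ring

end Reduction

/-! ### The sums `∑ t_l 𝓛_{l-k}` along a solution -/

/-- The function `ℓ_k = ∑_{l=k}^n t_l 𝓛_{l-k}[w_z - w²]`. -/
noncomputable def lenardSum (n : ℕ) (t : ℕ → 𝕜) (w : 𝕜 → 𝕜) (k : ℕ) (z : 𝕜) : 𝕜 :=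
  ∑ l ∈ Finset.Icc k n, time n t z l * lenardAt (l - k) w z

/-- The function `(d/dz + 2 w) ℓ_k`, with `ℓ_k` as in `lenardSum`. -/
noncomputable def lenardSumShift (n : ℕ) (t : ℕ → 𝕜) (w : 𝕜 → 𝕜) (k : ℕ) (z : 𝕜) : 𝕜 :=
  deriv (lenardSum n t w k) z + 2 * w z * lenardSum n t w k z

theorem sDenom_eq (n : ℕ) (t : ℕ → 𝕜) (w : 𝕜 → 𝕜) (z : 𝕜) :
    sDenom n t w z = 2 * lenardSum n t w 0 z := by
  rw [sDenom, lenardSum, Finset.range_eq_Ico]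
  rfl

section Sums

variable {n : ℕ} {t : ℕ → 𝕜} {α : 𝕜} {U : Set 𝕜} {w : 𝕜 → 𝕜}

theorem time_of_ne_zero {l : ℕ} (hl : l ≠ 0) (z : 𝕜) : time n t z l = time n t 0 l := by
  rw [time, time, if_neg hl, if_neg hl]

theorem hasDerivAt_time (l : ℕ) (z : 𝕜) :
    HasDerivAt (fun z => time n t z l) (if l = 0 then -1 else 0) z := by
  split_ifs with hl
  · simp only [time, if_pos hl]
    exact hasDerivAt_neg z
  · simp only [time_of_ne_zero hl]
    exact hasDerivAt_const _ _

theorem contDiffOn_lenardSum (hU : IsOpen U) (hw : ContDiffOn 𝕜 ∞ w U) (k : ℕ) :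
    ContDiffOn 𝕜 ∞ (lenardSum n t w k) U := by
  refine ContDiffOn.sum fun l _ => ContDiffOn.mul ?_ (contDiffOn_lenardAt hU hw _)
  by_cases hl : l = 0
  · simp only [time, if_pos hl]
    exact contDiffOn_id.neg
  · simp only [time_of_ne_zero hl]
    exact contDiffOn_const

/-- The term `1/2` comes from `t_0 = -z`, the only coefficient that depends on `z`. -/
theorem lenardSumShift_eq (hU : IsOpen U) (hw : ContDiffOn 𝕜 ∞ w U) (k : ℕ) {z : 𝕜}
    (hz : z ∈ U) : lenardSumShift n t w k z =
      ∑ l ∈ Finset.Icc k n, time n t z l * lenardShift (l - k) w z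
        - if k = 0 then 1 / 2 else 0 := by
  have h : HasDerivAt (lenardSum n t w k)
      (∑ l ∈ Finset.Icc k n, ((if l = 0 then -1 else 0) * lenardAt (l - k) w z
        + time n t z l * deriv (lenardAt (l - k) w) z)) z :=
    HasDerivAt.fun_sum fun l _ => (hasDerivAt_time l z).mul
      (hasDerivAt_of_contDiffOn hU (contDiffOn_lenardAt hU hw _) hz)
  have h0 : ∑ l ∈ Finset.Icc k n, (if l = 0 then -1 else 0) * lenardAt (l - k) w z =
      -if k = 0 then 1 / 2 else 0 := by
    split_ifs with hk
    · subst hk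
      rw [Finset.sum_eq_single_of_mem 0 (by simp) fun l _ hl => by rw [if_neg hl, zero_mul],
        lenardAt_zero]
      simp
    · rw [neg_zero]
      refine Finset.sum_eq_zero fun l hl => ?_
      rw [Finset.mem_Icc] at hl
      rw [if_neg (by omega), zero_mul]
  rw [lenardSumShift, h.deriv, Finset.sum_add_distrib, h0, lenardSum, Finset.mul_sum, add_assoc,
    ← Finset.sum_add_distrib, neg_add_eq_sub]
  congr 1
  refine Finset.sum_congr rfl fun l _ => ?_
  rw [lenardShift]
  ring

theorem deriv_lenardSumShift (hU : IsOpen U) (hw : ContDiffOn 𝕜 ∞ w U) {k : ℕ} (hk : k ≠ 0)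
    {z : 𝕜} (hz : z ∈ U) : deriv (lenardSumShift n t w k) z =
      ∑ l ∈ Finset.Icc k n, time n t z l * deriv (lenardShift (l - k) w) z := by
  have h : Set.EqOn (lenardSumShift n t w k)
      (fun z => ∑ l ∈ Finset.Icc k n, time n t 0 l * lenardShift (l - k) w z) U := by
    intro y hy
    rw [lenardSumShift_eq hU hw k hy, if_neg hk, sub_zero]
    refine Finset.sum_congr rfl fun l hl => ?_
    rw [Finset.mem_Icc] at hl
    rw [time_of_ne_zero (by omega)]
  rw [h.deriv hU hz]
  have h1 : HasDerivAt (fun z => ∑ l ∈ Finset.Icc k n, time n t 0 l * lenardShift (l - k) w z)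
      (∑ l ∈ Finset.Icc k n, time n t 0 l * deriv (lenardShift (l - k) w) z) z :=
    HasDerivAt.fun_sum fun l _ =>
      (hasDerivAt_of_contDiffOn hU (contDiffOn_lenardShift hU hw _) hz).const_mul _
  rw [h1.deriv]
  refine Finset.sum_congr rfl fun l hl => ?_
  rw [Finset.mem_Icc] at hl
  rw [time_of_ne_zero (l := l) (by omega) z]

/-- The equation `P_II^{(n)}(α)` says that `(d/dz + 2 w) ℓ_0 = α - 1/2`. -/
theorem lenardSumShift_zero_eq_iff (hn : 1 ≤ n) (hU : IsOpen U) (hw : ContDiffOn 𝕜 ∞ w U)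
    {z : 𝕜} (hz : z ∈ U) : lenardSumShift n t w 0 z = α - 1 / 2 ↔
      lenardShift n w z + ∑ l ∈ Finset.Icc 1 (n - 1), t l * lenardShift l w z = z * w z + α := by
  obtain ⟨m, rfl⟩ : ∃ m, n = m + 1 := ⟨n - 1, by omega⟩
  have h : ∑ l ∈ Finset.Icc 0 (m + 1), time (m + 1) t z l * lenardShift (l - 0) w z =
      -z * w z + (lenardShift (m + 1) w z + ∑ l ∈ Finset.Icc 1 m, t l * lenardShift l w z) := by
    rw [← Finset.add_sum_Ioc_eq_sum_Icc (Nat.zero_le _), Nat.sub_self, lenardShift_zero]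
    congr 1
    change ∑ l ∈ Finset.Icc 1 (m + 1), _ = _
    rw [Finset.sum_Icc_succ_top (by omega), add_comm]
    congr 1
    · simp [time]
    · refine Finset.sum_congr rfl fun l hl => ?_
      rw [Finset.mem_Icc] at hl
      rw [time, if_neg (by omega), if_neg (by omega), Nat.sub_zero]
  rw [lenardSumShift_eq hU hw 0 hz, h, if_pos rfl, Nat.add_sub_cancel]
  constructor <;> intro h' <;> linear_combination h'

theorem lenardSum_last (hn : 1 ≤ n) (z : 𝕜) : lenardSum n t w n z = 1 / 2 := by
  rw [lenardSum, Finset.Icc_self, Finset.sum_singleton, Nat.sub_self, lenardAt_zero, time,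
    if_neg (by omega), if_pos rfl, one_mul]

theorem lenardSumShift_last (hn : 1 ≤ n) (z : 𝕜) : lenardSumShift n t w n z = w z := by
  have h : lenardSum n t w n = fun _ => 1 / 2 := funext (lenardSum_last hn)
  rw [lenardSumShift, h, deriv_const]
  ring

theorem coeffA_eq (hU : IsOpen U) (hw : ContDiffOn 𝕜 ∞ w U) {k : ℕ} (hk : k < n) {z : 𝕜}
    (hz : z ∈ U) : coeffA n t w k z =
      4 ^ (k + 1) / 2 * (lenardSum n t w k z - deriv (lenardSumShift n t w (k + 1)) z) := by
  have h1 : ∑ l ∈ Finset.Icc 1 n, time n t z l * entryA l k w z - (if k = 0 then z else 0) =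
      time n t z k * 4 ^ k + ∑ l ∈ Finset.Ioc k n, time n t z l * entryA l k w z := by
    rcases Nat.eq_zero_or_pos k with rfl | hk0
    · rw [if_pos rfl, time, if_pos rfl, pow_zero]
      change ∑ l ∈ Finset.Ioc 0 n, _ - _ = _
      ring
    · rw [if_neg (by omega), sub_zero,
        ← Finset.sum_subset (Finset.Icc_subset_Icc_left hk0 : Finset.Icc k n ⊆ Finset.Icc 1 n),
        ← Finset.add_sum_Ioc_eq_sum_Icc hk.le, entryA, if_pos rfl]
      intro l hl hl'
      rw [Finset.mem_Icc] at hl hl'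
      rw [entryA, if_neg (by omega), if_neg (by omega), mul_zero]
  rw [coeffA, h1, deriv_lenardSumShift hU hw (by omega) hz, lenardSum,
    ← Finset.add_sum_Ioc_eq_sum_Icc hk.le, Nat.sub_self, lenardAt_zero, add_sub_assoc, mul_add]
  congr 1
  · rw [pow_succ]
    field_simp
    norm_num
  · rw [Finset.Icc_add_one_left_eq_Ioc, ← Finset.sum_sub_distrib, Finset.mul_sum]
    refine Finset.sum_congr rfl fun l hl => ?_
    rw [Finset.mem_Ioc] at hl
    rw [entryA, if_neg (by omega), if_pos hl.1, Nat.sub_sub]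
    ring

theorem coeffBodd_eq (hU : IsOpen U) (hw : ContDiffOn 𝕜 ∞ w U) (k : ℕ) {z : 𝕜} (hz : z ∈ U) :
    coeffBodd n t w k z = 4 ^ (k + 1) / 2 * deriv (lenardSumShift n t w (k + 1)) z := by
  rw [coeffBodd, deriv_lenardSumShift hU hw (by omega) hz, Finset.mul_sum,
    ← Finset.sum_subset (Finset.Icc_subset_Icc_left (by omega) :
      Finset.Icc (k + 1) n ⊆ Finset.Icc 1 n)]
  · refine Finset.sum_congr rfl fun l hl => ?_
    rw [Finset.mem_Icc] at hl
    rw [entryBodd, if_pos (by omega), Nat.sub_sub]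
    ring
  · intro l hl hl'
    rw [Finset.mem_Icc] at hl hl'
    rw [entryBodd, if_neg (by omega), mul_zero]

theorem coeffBeven_eq (hU : IsOpen U) (hw : ContDiffOn 𝕜 ∞ w U) {z : 𝕜} (hz : z ∈ U)
    (h0 : lenardSumShift n t w 0 z = α - 1 / 2) (k : ℕ) :
    coeffBeven n t α w k z =
      -4 ^ k * (lenardSumShift n t w k z + if k = 0 then 1 / 2 else 0) := by
  rw [coeffBeven]
  split_ifs with hk
  · rw [hk, h0]
    ring
  rw [lenardSumShift_eq hU hw k hz, if_neg hk, sub_zero, add_zero, Finset.mul_sum,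
    ← Finset.sum_subset (Finset.Icc_subset_Icc_left (by omega) :
      Finset.Icc k n ⊆ Finset.Icc 1 n)]
  · refine Finset.sum_congr rfl fun l hl => ?_
    rw [Finset.mem_Icc] at hl
    rw [entryBeven, if_pos (by omega)]
    ring
  · intro l hl hl'
    rw [Finset.mem_Icc] at hl hl'
    rw [entryBeven, if_neg (by omega), mul_zero]

/-- Along a solution the sigma function is a function of `z` and of `u = w_z - w²` alone. -/
theorem sigma_eq (hn : 1 ≤ n) (hU : IsOpen U) (hw : IsSolution n t α U w) {z : 𝕜} (hz : z ∈ U) :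
    sigma n hn t α w z =
      -(∑ l ∈ Finset.range n, lenardSum n t w l z * lenardSum n t w (n - l - 1) z
        + ∑ l ∈ Finset.range (n + 1),
          (deriv (lenardSum n t w l) z * deriv (lenardSum n t w (n - l)) z
            - 2 * (lenardSum n t w l z * deriv (deriv (lenardSum n t w (n - l))) z)
            - 4 * miura w z * (lenardSum n t w l z * lenardSum n t w (n - l) z))) := by
  have h0 : Set.EqOn (lenardSumShift n t w 0) (fun _ => α - 1 / 2) U := fun y hy =>
    (lenardSumShift_zero_eq_iff hn hU hw.1 hy).2 (hw.2 y hy)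
  have h := hamiltonian_reduction n hn two_ne_zero (w z) (deriv w z)
    (fun k => lenardSum n t w k z) (fun k => deriv (lenardSum n t w k) z)
    (fun k => deriv (deriv (lenardSum n t w k)) z) (fun k => lenardSumShift n t w k z)
    (fun k => deriv (lenardSumShift n t w k) z) (fun k => coeffA n t w k z)
    (fun k => coeffBodd n t w k z) (fun k => coeffBeven n t α w k z)
    (fun k => rfl)
    (fun k => by
      have d0 := hasDerivAt_of_contDiffOn hU hw.1 hz
      have d1 := hasDerivAt_of_contDiffOn hU (contDiffOn_lenardSum (n := n) (t := t) hU hw.1 k) hz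
      have d2 := hasDerivAt_of_contDiffOn hU
        (contDiffOn_deriv hU (contDiffOn_lenardSum (n := n) (t := t) hU hw.1 k)) hz
      have : HasDerivAt (lenardSumShift n t w k) _ z := d2.add ((d0.const_mul 2).mul d1)
      rw [this.deriv]
      ring)
    (by simp only [h0.deriv hU hz, deriv_const])
    (fun k hk => coeffA_eq hU hw.1 hk hz)
    (fun k _ => coeffBodd_eq hU hw.1 k hz)
    (fun k _ => coeffBeven_eq hU hw.1 hz (h0 hz) k)
  rw [show deriv w z - w z ^ 2 = miura w z from rfl] at h
  have key : ∀ S T x : 𝕜,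
      -(1 / 4 ^ n) * (4 ^ n * (S + T + x)) + -(-4 ^ n * x) / 4 ^ n = -(S + T) := by
    intro S T x
    field_simp
    ring
  rw [sigma, h, coordQ_last hn, coeffBeven_last hn, lenardSumShift_last hn]
  exact key _ _ _

end Sums

/-! ### The generator `s` -/

section Shift

variable {n : ℕ} {t : ℕ → 𝕜} {α : 𝕜} {U V : Set 𝕜} {w v : 𝕜 → 𝕜}

theorem eqOn_lenardAt_of_miura (hU : IsOpen U) (h : Set.EqOn (miura v) (miura w) U) (k : ℕ) :
    Set.EqOn (lenardAt k v) (lenardAt k w) U :=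
  fun _ hz => evalDiff_congr hU h _ hz

theorem eqOn_lenardSum_of_miura (hU : IsOpen U) (h : Set.EqOn (miura v) (miura w) U) (k : ℕ) :
    Set.EqOn (lenardSum n t v k) (lenardSum n t w k) U :=
  fun _ hz => Finset.sum_congr rfl fun _ _ => by rw [eqOn_lenardAt_of_miura hU h _ hz]

/-- Two solutions with the same Miura transform, possibly for different parameters, have the same
sigma function. -/
theorem sigma_eq_of_miura {β : 𝕜} (hn : 1 ≤ n) (hU : IsOpen U) (hw : IsSolution n t α U w)
    (hv : IsSolution n t β U v) (h : Set.EqOn (miura v) (miura w) U) {z : 𝕜} (hz : z ∈ U) :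
    sigma n hn t β v z = sigma n hn t α w z := by
  have e0 := fun k => eqOn_lenardSum_of_miura (n := n) (t := t) hU h k
  have e1 := fun k => (e0 k).deriv hU
  have e2 := fun k => (e1 k).deriv hU
  rw [sigma_eq hn hU hw hz, sigma_eq hn hU hv hz]
  simp only [h hz, e0 _ hz, e1 _ hz, e2 _ hz]

theorem IsSolution.mono (hw : IsSolution n t α U w) (hVU : V ⊆ U) : IsSolution n t α V w :=
  ⟨hw.1.mono hVU, fun z hz => hw.2 z (hVU hz)⟩

theorem contDiffOn_sDenom (hU : IsOpen U) (hw : ContDiffOn 𝕜 ∞ w U) :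
    ContDiffOn 𝕜 ∞ (sDenom n t w) U :=
  (contDiffOn_const.mul (contDiffOn_lenardSum (n := n) (t := t) hU hw 0)).congr
    fun z _ => sDenom_eq n t w z

theorem contDiffOn_sTransform (hU : IsOpen U) (hw : ContDiffOn 𝕜 ∞ w U)
    (h0 : ∀ z ∈ U, sDenom n t w z ≠ 0) : ContDiffOn 𝕜 ∞ (sTransform n t α w) U :=
  hw.sub (contDiffOn_const.div (contDiffOn_sDenom hU hw) h0)

/-- The transformation `s` preserves `w_z - w²`: the denominator `G` satisfies
`G_z + 2 w G = 2 α - 1`. -/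
theorem miura_sTransform (hn : 1 ≤ n) (hU : IsOpen U) (hw : IsSolution n t α U w)
    (h0 : ∀ z ∈ U, sDenom n t w z ≠ 0) :
    Set.EqOn (miura (sTransform n t α w)) (miura w) U := by
  intro z hz
  have hG : sDenom n t w z ≠ 0 := h0 z hz
  have d0 := hasDerivAt_of_contDiffOn hU hw.1 hz
  have d1 := hasDerivAt_of_contDiffOn hU
    (contDiffOn_lenardSum (n := n) (t := t) hU hw.1 0) hz
  have dG : HasDerivAt (sDenom n t w) (2 * deriv (lenardSum n t w 0) z) z := by
    rw [funext (sDenom_eq n t w)]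
    exact d1.const_mul 2
  have d : HasDerivAt (sTransform n t α w) _ z :=
    d0.sub ((hasDerivAt_const z (2 * α - 1)).div dG hG)
  have h := (lenardSumShift_zero_eq_iff hn hU hw.1 hz).2 (hw.2 z hz)
  rw [lenardSumShift] at h
  have h' : deriv (lenardSum n t w 0) z = α - 1 / 2 - w z * sDenom n t w z := by
    rw [sDenom_eq]
    linear_combination h
  rw [miura, miura, d.deriv, sTransform, h']
  field_simp
  ring

theorem IsSolution.sTransform (hn : 1 ≤ n) (hU : IsOpen U) (hw : IsSolution n t α U w)
    (h0 : ∀ z ∈ U, sDenom n t w z ≠ 0) : IsSolution n t (1 - α) U (sTransform n t α w) := by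
  have hs := contDiffOn_sTransform (α := α) hU hw.1 h0
  refine ⟨hs, fun z hz => (lenardSumShift_zero_eq_iff hn hU hs hz).1 ?_⟩
  have h := (lenardSumShift_zero_eq_iff hn hU hw.1 hz).2 (hw.2 z hz)
  have e := eqOn_lenardSum_of_miura (n := n) (t := t) hU (miura_sTransform hn hU hw h0) 0
  have hG : lenardSum n t w 0 z ≠ 0 := fun h' => h0 z hz (by rw [sDenom_eq, h', mul_zero])
  rw [lenardSumShift] at h ⊢
  rw [e.deriv hU hz, e hz, PainleveII.sTransform, sDenom_eq]
  have : (2 * α - 1) / (2 * lenardSum n t w 0 z) * lenardSum n t w 0 z = α - 1 / 2 := by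
    field_simp
  linear_combination h - 2 * this

theorem isOpen_sDenom_ne_zero (hU : IsOpen U) (hw : ContDiffOn 𝕜 ∞ w U) :
    IsOpen {z ∈ U | sDenom n t w z ≠ 0} :=
  (contDiffOn_sDenom hU hw).continuousOn.isOpen_inter_preimage hU isOpen_ne

end Shift

end PainleveII

theorem theorem4p1 {𝕜 : Type*} [RCLike 𝕜] (n : ℕ) (hn : 1 ≤ n) (t : ℕ → 𝕜) (α : 𝕜)
    (U : Set 𝕜) (hU : IsOpen U) (w : 𝕜 → 𝕜) (hw : PainleveII.IsSolution n t α U w) :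
    (PainleveII.IsSolution n t (1 - α) {z ∈ U | PainleveII.sDenom n t w z ≠ 0}
        (PainleveII.sTransform n t α w) ∧
      ∀ z ∈ U, PainleveII.sDenom n t w z ≠ 0 →
        PainleveII.sigma n hn t (1 - α) (PainleveII.sTransform n t α w) z =
          PainleveII.sigma n hn t α w z) ∧
    (PainleveII.IsSolution n t (-α) U (fun z => -w z) ∧
      ∀ z ∈ U, PainleveII.sigma n hn t (-α) (fun x => -w x) z =
        PainleveII.sigma n hn t α w z - 2 * w z) := by
  have hV : IsOpen {z ∈ U | PainleveII.sDenom n t w z ≠ 0} :=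
    PainleveII.isOpen_sDenom_ne_zero hU hw.1
  have hwV : PainleveII.IsSolution n t α {z ∈ U | PainleveII.sDenom n t w z ≠ 0} w :=
    hw.mono fun _ hz => hz.1
  have hs := hwV.sTransform hn hV fun _ hz => hz.2
  exact ⟨⟨hs, fun z hz hG => PainleveII.sigma_eq_of_miura hn hV hwV hs
      (PainleveII.miura_sTransform hn hV hwV fun _ hz => hz.2) ⟨hz, hG⟩⟩,
    hw.neg hU, fun z hz => PainleveII.sigma_neg hn hU hw.1 hz⟩
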